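/- Let $\{B_v\}_{v\in V}$ be an infinite family of pairwise disjoint open disks of radius $\tfrac12$ in the Euclidean plane $\mathbb R^2$, and let $c_v$ denote the center of $B_v$. Let $(V,E)$ be the contact graph of the family, in which $v,w\in V$ are joined by an edge if and only if the circles $\partial B_v$ and $\partial B_w$ are tangent, that is, $|c_v-c_w|=1$. Assume that $(V,E)$ is connected. Draw each vertex $v$ as the point $c_v$ and each edge $\{v,w\}$ as the straight segment $\overline{c_vc_w}$. Let $F$ be the set of faces, i.e. of connected components of the complement in $\mathbb R^2$ of the resulting drawing, and for $\sigma\in F$ let the facial degree $\deg(\sigma)\in\mathbb N\cup\{\infty\}$ be the number of corners of $\sigma$, i.e. of pairs consisting of a vertex $v$ and an open circular sector of $B_v$, cut out by the edges at $v$, that is contained in $\sigma$ (straight angles and full angles count, and a vertex may contribute several corners). Suppose that $$\sup_{\sigma\in F}\deg(\sigma)<\infty .$$ Let $d_V$ be the combinatorial distance of $(V,E)$, and let $d_{\mathbb Z^2}$ be the combinatorial distance of the graph with vertex set $\mathbb Z^2$ in which $w,z$ are adjacent if and only if $|w-z|=1$. Then the metric spaces $(V,d_V)$ and $(\mathbb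 Z^2,d_{\mathbb Z^2})$ are quasi-isometric: there are a map $\psi:V\to\mathbb Z^2$ and constants $a\ge 1$, $C>0$ such that $$a^{-1}d_V(x_1,x_2)-C\le d_{\mathbb Z^2}(\psi(x_1),\psi(x_2))\le a\,d_V(x_1,x_2)+C\qquad\text{for all }x_1,x_2\in V,$$ and for every $y\in\mathbb Z^2$ there is an $x\in V$ with $d_{\mathbb Z^2}(y,\psi(x))<C$. -/

import Mathlib

/-- A configuration of pennies in the Euclidean plane, indexed by `V`: the penny with index `v` is
the open disk of radius `1/2` around `center v`, and pennies of different index do not overlap. -/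
structure PennyConfiguration (V : Type*) where
  center : V → EuclideanSpace ℝ (Fin 2)
  disjoint_pennies : ∀ v w : V, v ≠ w →
    Disjoint (Metric.ball (center v) (1 / 2)) (Metric.ball (center w) (1 / 2))

namespace PennyConfiguration

variable {V : Type*}

/-- The penny with index `v`, an open disk of diameter `1`. -/
def penny (P : PennyConfiguration V) (v : V) : Set (EuclideanSpace ℝ (Fin 2)) :=
  Metric.ball (P.center v) (1 / 2)

/-- The contact graph. Two circles of radius `1/2` bounding disjoint disks are tangent exactly when
their centers are at distance `1/2 + 1/2 = 1`. -/
def graph (P : PennyConfiguration V) : SimpleGraph V where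
  Adj v w := dist (P.center v) (P.center w) = 1
  symm := ⟨fun v w h => by rw [dist_comm]; exact h⟩
  loopless := ⟨fun v h => by simp at h⟩

/-- The image in the plane of the geometric realization: all the centers, together with the
straight segments that join the centers of tangent pennies. -/
def drawing (P : PennyConfiguration V) : Set (EuclideanSpace ℝ (Fin 2)) :=
  Set.range P.center ∪
    ⋃ (v : V) (w : V) (_ : P.graph.Adj v w), segment ℝ (P.center v) (P.center w)

/-- The faces: the connected components of the complement of the drawing. -/
def faces (P : PennyConfiguration V) : Set (Set (EuclideanSpace ℝ (Fin 2))) :=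
  {σ | ∃ x ∈ P.drawingᶜ, σ = connectedComponentIn P.drawingᶜ x}

/-- The corners (interior angles) of a face `σ`, each given by its vertex `v` and its circular
sector at `v`. Inside the penny of `v` the drawing consists only of `center v` and of the radii
towards the neighbours of `v`, so the connected components of `σ ∩ penny v` are the open sectors
between cyclically consecutive edges at `v` that belong to `σ`. Straight angles, reflex angles, and
the full angle at a vertex of degree one all count, and a face may have several corners at the
same vertex. -/
def corners (P : PennyConfiguration V) (σ : Set (EuclideanSpace ℝ (Fin 2))) :
    Set (V × Set (EuclideanSpace ℝ (Fin 2))) :=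
  {c | ∃ x ∈ σ ∩ P.penny c.1, c.2 = connectedComponentIn (σ ∩ P.penny c.1) x}

/-- The facial degree of a face: its number of corners, possibly infinite. -/
noncomputable def facialDegree (P : PennyConfiguration V)
    (σ : Set (EuclideanSpace ℝ (Fin 2))) : ℕ∞ :=
  (P.corners σ).encard

end PennyConfiguration

/-- The integer lattice graph: `w` and `z` are adjacent when their Euclidean distance is `1`. -/
def latticeGraph : SimpleGraph (ℤ × ℤ) where
  Adj w z := (w.1 - z.1) ^ 2 + (w.2 - z.2) ^ 2 = 1
  symm := ⟨fun w z h => by rw [← h]; ring⟩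
  loopless := ⟨fun w h => by simp at h⟩

/-- The combinatorial distance of a (connected) graph, as a real number. -/
noncomputable def graphDist {V : Type*} (G : SimpleGraph V) (x y : V) : ℝ := (G.dist x y : ℝ)

/-- Quasi-isometry of the spaces `X` and `Y` with the distance functions `dX` and `dY`. -/
def QuasiIsometric {X Y : Type*} (dX : X → X → ℝ) (dY : Y → Y → ℝ) : Prop :=
  ∃ (ψ : X → Y) (a C : ℝ), 1 ≤ a ∧ 0 < C ∧
    (∀ x₁ x₂ : X, a⁻¹ * dX x₁ x₂ - C ≤ dY (ψ x₁) (ψ x₂) ∧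
      dY (ψ x₁) (ψ x₂) ≤ a * dX x₁ x₂ + C) ∧
    (∀ y : Y, ∃ x : X, dY y (ψ x) < C)

/-!
Since the drawing is connected, unicoherence of the plane makes the boundary of every face
connected. Along this boundary, consecutive corners of the face belong to equal or adjacent
vertices, so a bound `D` on the facial degree bounds the graph distance between any two corners of
the face. It also bounds the extent of the face: a face reaching beyond a disk of radius `D + 1`
around one of its corners would contain the whole exterior of that disk, where infinitely many
centers lie.

Assign to each point of the plane an anchor, that is, a corner of the face containing the point or a
vertex of the drawing next to it. An anchor is close to its point and moves a bounded graph distance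
under small displacements. A unit disk has boundedly many anchors by packing, and is connected, so
anchors of points at distance at most `1` are at bounded graph distance. Hence the graph distance is
at most linear in the Euclidean distance, and `v ↦ c_v` is a quasi-isometry to the plane; rounding
coordinates down continues it to the lattice.
-/

open Set Filter Topology Metric

/-- Unicoherence. If the intersection of `s` and `t` were split by a Urysohn function `f`, the loop
that is `exp (2πif)` on `s` and constant on `t` would wind once around the circle and could not lift
to `ℝ`. -/
theorem isPreconnected_inter_of_union_eq_univ {X : Type*} [TopologicalSpace X]
    [SimplyConnectedSpace X] [LocallyPathConnectedSpace X] [NormalSpace X] {s t : Set X}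
    (hs : IsPreconnected s) (ht : IsPreconnected t) (hsc : IsClosed s) (htc : IsClosed t)
    (hst : s ∪ t = univ) : IsPreconnected (s ∩ t) := by
  classical
  rw [isPreconnected_closed_iff]
  rintro A B hA hB hAB ⟨a, ha, haA⟩ ⟨b, hb, hbB⟩
  by_contra hAB_disj
  obtain ⟨f, hf_zero, hf_one, -⟩ := exists_continuous_zero_one_of_isClosed
    ((hsc.inter htc).inter hA) ((hsc.inter htc).inter hB)
    (Set.disjoint_left.2 fun x hxA hxB => hAB_disj ⟨x, hxA.1, hxA.2, hxB.2⟩)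
  let g : X → Circle := s.piecewise (fun x => Circle.exp (2 * Real.pi * f x)) 1
  have hgs : EqOn g (fun x => Circle.exp (2 * Real.pi * f x)) s := piecewise_eqOn s _ _
  have hgt : EqOn g 1 t := fun x hx => by
    by_cases hxs : x ∈ s
    · rcases hAB ⟨hxs, hx⟩ with h | h
      · simp [hgs hxs, hf_zero ⟨⟨hxs, hx⟩, h⟩]
      · simp [hgs hxs, hf_one ⟨⟨hxs, hx⟩, h⟩]
    · exact piecewise_eq_of_notMem s _ _ hxs
  have hg : Continuous g := by
    rw [← continuousOn_univ, ← hst]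
    exact (Continuous.continuousOn (by fun_prop)).congr hgs |>.union_of_isClosed
      (continuousOn_const.congr hgt) hsc htc
  have hfa : f a = 0 := hf_zero ⟨ha, haA⟩
  have hfb : f b = 1 := hf_one ⟨hb, hbB⟩
  obtain ⟨φ, ⟨hφa, hφ⟩, -⟩ := Circle.isCoveringMap_exp.existsUnique_continuousMap_lifts
    ⟨g, hg⟩ a 0 (by simp [hgt ha.2])
  have hφs : EqOn φ (fun x => 2 * Real.pi * f x) s :=
    Circle.isCoveringMap_exp.eqOn_of_comp_eqOn hs (by fun_prop) (by fun_prop)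
      (fun x hx => (congrFun hφ x).trans (hgs hx)) ha.1 (by simp [hφa, hfa])
  have hφt : EqOn φ 0 t :=
    Circle.isCoveringMap_exp.eqOn_of_comp_eqOn ht (by fun_prop) continuousOn_const
      (fun x hx => (congrFun hφ x).trans (by simp [hgt hx])) ha.2 hφa
  have h_winding : 2 * Real.pi * f b = 0 := (hφs hb.1).symm.trans (hφt hb.2)
  simp [hfb, Real.pi_ne_zero] at h_winding

section ConnectedComponentIn

variable {X : Type*} [TopologicalSpace X] [LocallyConnectedSpace X]

theorem frontier_connectedComponentIn_subset_compl {U : Set X} (hU : IsOpen U) (x : X) :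
    frontier (connectedComponentIn U x) ⊆ Uᶜ := by
  intro y hy hyU
  obtain ⟨z, hzy, hzx⟩ := mem_closure_iff.1 (frontier_subset_closure hy) _
    hU.connectedComponentIn (mem_connectedComponentIn hyU)
  rw [hU.connectedComponentIn.frontier_eq, connectedComponentIn_eq hzx,
    ← connectedComponentIn_eq hzy] at hy
  exact hy.2 (mem_connectedComponentIn hyU)

theorem isPreconnected_compl_connectedComponentIn_compl [PreconnectedSpace X] {A : Set X}
    (hA : IsConnected A) (hAc : IsClosed A) (x : X) :
    IsPreconnected (connectedComponentIn Aᶜ x)ᶜ := by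
  obtain ⟨a, ha⟩ := hA.nonempty
  have hAσ : A ⊆ (connectedComponentIn Aᶜ x)ᶜ :=
    subset_compl_comm.1 (connectedComponentIn_subset _ _)
  refine isPreconnected_of_forall a fun y hy => ?_
  by_cases hyA : y ∈ A
  · exact ⟨A, hAσ, ha, hyA, hA.isPreconnected⟩
  have hyτ : y ∈ connectedComponentIn Aᶜ y := mem_connectedComponentIn hyA
  obtain ⟨z, hz⟩ : (frontier (connectedComponentIn Aᶜ y)).Nonempty :=
    nonempty_frontier_iff.2 ⟨⟨y, hyτ⟩, fun h =>
      connectedComponentIn_subset Aᶜ y (h ▸ mem_univ a) ha⟩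
  have hdisj : Disjoint (connectedComponentIn Aᶜ y) (connectedComponentIn Aᶜ x) :=
    Set.disjoint_left.2 fun w hwy hwx =>
      hy (connectedComponentIn_eq hwx ▸ connectedComponentIn_eq hwy ▸ hyτ)
  refine ⟨A ∪ closure (connectedComponentIn Aᶜ y), union_subset hAσ ?_, Or.inl ha,
    Or.inr (subset_closure hyτ), ?_⟩
  · exact (hdisj.closure_left hAc.isOpen_compl.connectedComponentIn).subset_compl_right
  · exact hA.isPreconnected.union z
      (compl_compl A ▸ frontier_connectedComponentIn_subset_compl hAc.isOpen_compl y hz)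
      (frontier_subset_closure hz) isPreconnected_connectedComponentIn.closure

end ConnectedComponentIn

theorem isPreconnected_frontier_connectedComponentIn_compl {X : Type*} [TopologicalSpace X]
    [SimplyConnectedSpace X] [LocallyPathConnectedSpace X] [NormalSpace X] {A : Set X}
    (hA : IsConnected A) (hAc : IsClosed A) (x : X) :
    IsPreconnected (frontier (connectedComponentIn Aᶜ x)) := by
  have hσ : IsOpen (connectedComponentIn Aᶜ x) := hAc.isOpen_compl.connectedComponentIn
  rw [hσ.frontier_eq, sdiff_eq]
  refine isPreconnected_inter_of_union_eq_univ isPreconnected_connectedComponentIn.closure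
    (isPreconnected_compl_connectedComponentIn_compl hA hAc x) isClosed_closure hσ.isClosed_compl ?_
  exact univ_subset_iff.1 (union_compl_self _ ▸ union_subset_union_left _ subset_closure)

theorem inter_frontier_nonempty_of_isPreconnected {X : Type*} [TopologicalSpace X] {s t : Set X}
    (ht : IsPreconnected t) (h : (t ∩ s).Nonempty) (h' : (t ∩ sᶜ).Nonempty) :
    (t ∩ frontier s).Nonempty := by
  rw [frontier_eq_closure_inter_closure]
  exact isPreconnected_closed_iff.1 ht (closure s) (closure sᶜ) isClosed_closure isClosed_closure
    (fun x _ => (em (x ∈ s)).imp (subset_closure ·) (subset_closure ·))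
    (h.mono (inter_subset_inter_right _ subset_closure))
    (h'.mono (inter_subset_inter_right _ subset_closure))

theorem isPreconnected_compl_closedBall {E : Type*} [NormedAddCommGroup E] [NormedSpace ℝ E]
    (h : 1 < Module.rank ℝ E) (x : E) {r : ℝ} (hr : 0 ≤ r) :
    IsPreconnected (closedBall x r)ᶜ := by
  have h_polar : (closedBall x r)ᶜ =
      (fun p : ℝ × E => x + p.1 • p.2) '' (Ioi r ×ˢ sphere (0 : E) 1) := by
    ext y
    simp only [mem_compl_iff, mem_closedBall, not_le, mem_image, mem_prod, mem_Ioi,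
      mem_sphere_zero_iff_norm, Prod.exists, dist_eq_norm]
    constructor
    · intro hy
      have h0 : ‖y - x‖ ≠ 0 := (hr.trans_lt hy).ne'
      exact ⟨‖y - x‖, ‖y - x‖⁻¹ • (y - x), ⟨hy, by simp [norm_smul, h0]⟩, by simp [smul_smul, h0]⟩
    · rintro ⟨t, u, ⟨ht, hu⟩, rfl⟩
      simpa [norm_smul, hu] using ht.trans_le (le_abs_self t)
  rw [h_polar]
  exact (isPreconnected_Ioi.prod (isPreconnected_sphere h 0 1)).image _ (by fun_prop)

theorem exists_forall_encard_le_of_pairwise_le_dist {E ι : Type*} [SeminormedAddCommGroup E]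
    [ProperSpace E] {c : ι → E} {δ : ℝ} (hδ : 0 < δ)
    (hc : Pairwise fun i j => δ ≤ dist (c i) (c j)) (r : ℝ) :
    ∃ N : ℕ, ∀ x, {i | c i ∈ closedBall x r}.encard ≤ N := by
  obtain ⟨t, ht, hcover⟩ := totallyBounded_iff.1 (isCompact_closedBall (0 : E) r).totallyBounded
    (δ / 2) (half_pos hδ)
  refine ⟨t.ncard, fun x => ?_⟩
  have h_near : ∀ i, ∃ y, c i ∈ closedBall x r → y ∈ t ∧ dist (c i - x) y < δ / 2 := fun i => by
    by_cases hi : c i ∈ closedBall x r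
    · have hi' : c i - x ∈ closedBall 0 r := by simpa [dist_eq_norm] using hi
      obtain ⟨y, hyt, hy⟩ := mem_iUnion₂.1 (hcover hi')
      exact ⟨y, fun _ => ⟨hyt, hy⟩⟩
    · exact ⟨0, fun h => absurd h hi⟩
  choose y hy using h_near
  rw [ht.cast_ncard_eq]
  refine encard_le_encard_of_injOn (f := y) (fun i hi => (hy i hi).1) fun i hi j hj hij => ?_
  by_contra hne
  have h_triangle := dist_triangle_right (c i - x) (c j - x) (y i)
  rw [dist_sub_right] at h_triangle
  linarith [hc hne, (hy i hi).2, hij ▸ (hy j hj).2]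

section GraphDist

variable {V : Type*} {G : SimpleGraph V}

theorem graphDist_self (v : V) : graphDist G v v = 0 := by
  simp [graphDist]

theorem graphDist_comm (v w : V) : graphDist G v w = graphDist G w v := by
  simp only [graphDist, SimpleGraph.dist_comm]

theorem graphDist_triangle (hG : G.Connected) (u v w : V) :
    graphDist G u w ≤ graphDist G u v + graphDist G v w := by
  simp only [graphDist]
  exact_mod_cast hG.dist_triangle

theorem graphDist_le_one_of_eq_or_adj {v w : V} (h : v = w ∨ G.Adj v w) : graphDist G v w ≤ 1 := by
  rcases h with rfl | h
  · simp [graphDist]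
  · simp [graphDist, SimpleGraph.dist_eq_one_iff_adj.2 h]

theorem le_mul_walk_length {d : V → V → ℝ} {k : ℝ} (h_self : ∀ v, d v v = 0)
    (h_triangle : ∀ u v w, d u w ≤ d u v + d v w) (h_adj : ∀ v w, G.Adj v w → d v w ≤ k) :
    ∀ {v w : V} (p : G.Walk v w), d v w ≤ k * p.length
  | v, _, .nil => by simp [h_self]
  | u, w, .cons (v := v) huv p => by
    have h_tail := le_mul_walk_length h_self h_triangle h_adj p
    rw [SimpleGraph.Walk.length_cons]
    push_cast
    linarith [h_triangle u v w, h_adj u v huv]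

theorem le_mul_graphDist (hG : G.Connected) {d : V → V → ℝ} {k : ℝ} (h_self : ∀ v, d v v = 0)
    (h_triangle : ∀ u v w, d u w ≤ d u v + d v w) (h_adj : ∀ v w, G.Adj v w → d v w ≤ k)
    (v w : V) : d v w ≤ k * graphDist G v w := by
  obtain ⟨p, hp⟩ := hG.exists_walk_length_eq_dist v w
  rw [graphDist, ← hp]
  exact le_mul_walk_length h_self h_triangle h_adj p

theorem reachable_of_isPreconnected {X : Type*} [TopologicalSpace X] {S : Set X}
    (hS : IsPreconnected S) {R : X → V → Prop} (hR : ∀ x ∈ S, ∃ v, R x v)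
    (h_loc : ∀ x ∈ S, ∀ v, R x v → ∀ᶠ y in 𝓝[S] x, ∀ w, R y w → G.Reachable v w)
    {x y : X} (hx : x ∈ S) (hy : y ∈ S) {v w : V} (hv : R x v) (hw : R y w) :
    G.Reachable v w := by
  refine hS.induction₂ (fun x y => ∀ v w, R x v → R y w → G.Reachable v w) (fun x hx => ?_)
    (fun x y z _ hy _ hxy hyz u w hu hw => ?_) (fun x y _ _ hxy v w hv hw => (hxy w v hw hv).symm)
    hx hy v w hv hw
  · obtain ⟨u, hu⟩ := hR x hx
    have h_near := h_loc x hx u hu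
    filter_upwards [h_near] with y hy v w hv hw
    exact (h_near.self_of_nhdsWithin hx v hv).symm.trans (hy w hw)
  · obtain ⟨v, hv⟩ := hR y hy
    exact (hxy u v hu hv).trans (hyz v w hv hw)

theorem graphDist_le_of_isPreconnected {X : Type*} [TopologicalSpace X] (hG : G.Connected)
    {S : Set X} (hS : IsPreconnected S) {R : X → V → Prop} {k : ℝ} {N : ℕ}
    (hR : ∀ x ∈ S, ∃ v, R x v)
    (h_loc : ∀ x ∈ S, ∀ v, R x v → ∀ᶠ y in 𝓝[S] x, ∀ w, R y w → graphDist G v w ≤ k)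
    (hN : {v | ∃ x ∈ S, R x v}.encard ≤ N)
    {x y : X} (hx : x ∈ S) (hy : y ∈ S) {v w : V} (hv : R x v) (hw : R y w) :
    graphDist G v w ≤ k * N := by
  set U : Set V := {v | ∃ x ∈ S, R x v}
  have : Fintype U := (finite_of_encard_le_coe hN).fintype
  have hk : 0 ≤ k := (graphDist_self v).symm.trans_le ((h_loc x hx v hv).self_of_nhdsWithin hx v hv)
  let H : SimpleGraph U := SimpleGraph.fromRel fun u u' => graphDist G u u' ≤ k
  have h_adj : ∀ u u' : U, H.Adj u u' → graphDist G u u' ≤ k := by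
    rintro u u' ⟨-, h | h⟩
    · exact h
    · exact (graphDist_comm _ _).trans_le h
  have h_reach : H.Reachable ⟨v, x, hx, hv⟩ ⟨w, y, hy, hw⟩ := by
    refine reachable_of_isPreconnected (R := fun x (u : U) => R x u) hS
      (fun x hx => (hR x hx).elim fun v hv => ⟨⟨v, x, hx, hv⟩, hv⟩)
      (fun x hx u hu => ?_) hx hy hv hw
    filter_upwards [h_loc x hx u hu] with y hy u' hu'
    by_cases h : u = u'
    · rw [h]
    · exact SimpleGraph.Adj.reachable ⟨h, Or.inl (hy u' hu')⟩
  obtain ⟨p, hp⟩ := h_reach.exists_isPath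
  have h_length : p.length ≤ N := by
    rw [← coe_fintypeCard, Nat.cast_le] at hN
    exact hp.length_lt.le.trans hN
  calc graphDist G v w ≤ k * p.length :=
        le_mul_walk_length (d := fun u u' : U => graphDist G u u') (fun _ => graphDist_self _)
          (fun _ _ _ => graphDist_triangle hG _ _ _) h_adj p
    _ ≤ k * N := by gcongr

theorem graphDist_le_mul_dist_add_one {E : Type*} [NormedAddCommGroup E] [NormedSpace ℝ E]
    (hG : G.Connected) {R : E → V → Prop} (hR : ∀ x, ∃ v, R x v) {K : ℝ}
    (hK : ∀ x y v w, R x v → R y w → dist x y ≤ 1 → graphDist G v w ≤ K)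
    {x y : E} {v w : V} (hv : R x v) (hw : R y w) :
    graphDist G v w ≤ K * (dist x y + 1) := by
  have hK₀ : 0 ≤ K := (graphDist_self v).symm.trans_le (hK x x v v hv hv (by simp))
  have h_steps : ∀ (n : ℕ) (y : E) (w : V), R y w → dist x y ≤ n + 1 →
      graphDist G v w ≤ K * (n + 1) := by
    intro n
    induction n with
    | zero => exact fun y w hw hxy => by simpa using hK x y v w hv hw (by simpa using hxy)
    | succ n ih =>
      intro y w hw hxy
      push_cast at hxy ⊢
      obtain ⟨z, hxz, hzy⟩ := exists_dist_le_le (by positivity) zero_le_one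
        (hxy.trans_eq (add_comm _ _))
      obtain ⟨u, hu⟩ := hR z
      linarith [graphDist_triangle hG v u w, ih z u hu hxz, hK z y u w hu hw hzy]
  refine (h_steps ⌊dist x y⌋₊ y w hw (Nat.lt_floor_add_one _).le).trans ?_
  gcongr
  exact Nat.floor_le dist_nonneg

end GraphDist

section InnerProductSpace

variable {E : Type*} [NormedAddCommGroup E] [InnerProductSpace ℝ E]

theorem dist_lineMap_sq (c a b : E) (t : ℝ) :
    dist c (AffineMap.lineMap a b t) ^ 2 =
      (1 - t) * dist c a ^ 2 + t * dist c b ^ 2 - t * (1 - t) * dist a b ^ 2 := by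
  have h_ab : b - a = (c - a) - (c - b) := by abel
  have h_t : c - AffineMap.lineMap a b t = (c - a) - t • (b - a) := by
    rw [AffineMap.lineMap_apply, vsub_eq_sub, vadd_eq_add]; abel
  rw [dist_comm a b, dist_eq_norm, dist_eq_norm, dist_eq_norm, dist_eq_norm, h_t, h_ab,
    norm_sub_sq_real (c - a) (t • _), inner_smul_right, norm_smul, mul_pow, Real.norm_eq_abs,
    sq_abs, norm_sub_sq_real (c - a) (c - b), inner_sub_right, real_inner_self_eq_norm_sq]
  ring

theorem dist_midpoint_sq (c a b : E) :
    dist c (midpoint ℝ a b) ^ 2 = (dist c a ^ 2 + dist c b ^ 2) / 2 - dist a b ^ 2 / 4 := by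
  rw [midpoint, dist_lineMap_sq, invOf_eq_inv]
  ring

theorem one_fourth_lt_dist_of_mem_segment {u w m p : E} (huw : dist u w = 1)
    (hu : 3 / 4 ≤ dist m u ^ 2) (hw : 1 / 4 ≤ dist m w ^ 2) (hp : p ∈ segment ℝ u w) :
    1 / 4 < dist m p := by
  rw [segment_eq_image_lineMap] at hp
  obtain ⟨t, ⟨ht₀, ht₁⟩, rfl⟩ := hp
  refine lt_of_pow_lt_pow_left₀ 2 dist_nonneg ?_
  rw [dist_lineMap_sq, huw]
  nlinarith [sq_nonneg (t - 3 / 4), mul_le_mul_of_nonneg_left hu (sub_nonneg.2 ht₁),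
    mul_le_mul_of_nonneg_left hw ht₀]

end InnerProductSpace

theorem mem_segment_of_mem_line {E : Type*} [NormedAddCommGroup E] [NormedSpace ℝ E] {a b x : E}
    (hx : x ∈ line[ℝ, a, b]) (h : dist x (midpoint ℝ a b) ≤ dist a b / 2) :
    x ∈ segment ℝ a b := by
  obtain ⟨t, rfl⟩ := mem_affineSpan_pair_iff_exists_lineMap_eq.1 hx
  rcases eq_or_ne a b with rfl | hab
  · simp
  · rw [midpoint, dist_lineMap_lineMap, div_eq_inv_mul, Real.dist_eq, invOf_eq_inv] at h
    have h_t := abs_le.1 (le_of_mul_le_mul_right h (dist_pos.2 hab))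
    rw [segment_eq_image_lineMap]
    exact ⟨t, ⟨by linarith, by linarith⟩, rfl⟩

namespace PennyConfiguration

variable {V : Type*} (P : PennyConfiguration V) {x y : EuclideanSpace ℝ (Fin 2)} {v w : V}

theorem one_le_dist_center (h : v ≠ w) : 1 ≤ dist (P.center v) (P.center w) := by
  have h_add := (disjoint_ball_ball_iff (by norm_num) (by norm_num)).1 (P.disjoint_pennies v w h)
  linarith

variable {P} in
theorem eq_or_adj_of_mem_closedBall (hv : x ∈ closedBall (P.center v) (1 / 2))
    (hw : x ∈ closedBall (P.center w) (1 / 2)) : v = w ∨ P.graph.Adj v w := by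
  refine or_iff_not_imp_left.2 fun hne => le_antisymm ?_ (P.one_le_dist_center hne)
  rw [mem_closedBall] at hv hw
  linarith [dist_triangle_left (P.center v) (P.center w) x]

theorem exists_forall_encard_center_le (r : ℝ) :
    ∃ N : ℕ, ∀ x, {v | P.center v ∈ closedBall x r}.encard ≤ N :=
  exists_forall_encard_le_of_pairwise_le_dist one_pos (fun _ _ => P.one_le_dist_center) r

theorem finite_center_mem_closedBall (x : EuclideanSpace ℝ (Fin 2)) (r : ℝ) :
    {v | P.center v ∈ closedBall x r}.Finite :=
  (P.exists_forall_encard_center_le r).elim fun _ hN => finite_of_encard_le_coe (hN x)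

theorem locallyFinite_closedBall (r : ℝ) :
    LocallyFinite fun v => closedBall (P.center v) r := by
  refine fun x => ⟨closedBall x 1, closedBall_mem_nhds x one_pos,
    (P.finite_center_mem_closedBall x (r + 1)).subset ?_⟩
  rintro v ⟨y, hyv, hyx⟩
  rw [mem_closedBall] at hyv hyx
  rw [mem_ofPred_eq, mem_closedBall]
  linarith [dist_triangle_left (P.center v) x y]

section Drawing

/-- The part of the drawing consisting of a vertex and the edges at it. -/
def star (v : V) : Set (EuclideanSpace ℝ (Fin 2)) :=
  insert (P.center v) (⋃ w ∈ P.graph.neighborSet v, segment ℝ (P.center v) (P.center w))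

theorem drawing_eq_iUnion_star : P.drawing = ⋃ v, P.star v := by
  ext x
  simp only [drawing, star, mem_union, mem_range, mem_iUnion, mem_insert_iff, exists_or,
    SimpleGraph.mem_neighborSet, exists_prop, eq_comm]

variable {P}

theorem center_mem_drawing : P.center v ∈ P.drawing := Or.inl ⟨v, rfl⟩

theorem segment_subset_drawing (h : P.graph.Adj v w) :
    segment ℝ (P.center v) (P.center w) ⊆ P.drawing := fun _ hx =>
  Or.inr (mem_iUnion.2 ⟨v, mem_iUnion₂.2 ⟨w, h, hx⟩⟩)

theorem star_subset_closedBall : P.star v ⊆ closedBall (P.center v) 1 := by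
  refine insert_subset (mem_closedBall_self zero_le_one) (iUnion₂_subset fun w hw => ?_)
  refine (convex_closedBall _ _).segment_subset (mem_closedBall_self zero_le_one) ?_
  rw [mem_closedBall']
  exact le_of_eq hw

theorem isClosed_star : IsClosed (P.star v) := by
  have h_fin : (P.graph.neighborSet v).Finite :=
    (P.finite_center_mem_closedBall (P.center v) 1).subset fun w hw => by
      rw [mem_ofPred_eq, mem_closedBall']
      exact le_of_eq hw
  refine isClosed_singleton.union (h_fin.isClosed_biUnion fun w _ => ?_)
  rw [segment_eq_image]
  exact (isCompact_Icc.image (by fun_prop)).isClosed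

theorem isConnected_star : IsConnected (P.star v) := by
  refine (StarConvex.isPathConnected (a := P.center v) (starConvex_iff_segment_subset.2 ?_)
    (mem_insert _ _)).isConnected
  intro y hy
  rcases hy with rfl | hy
  · rw [segment_same]
    exact singleton_subset_iff.2 (mem_insert _ _)
  · obtain ⟨w, hw, hyw⟩ := mem_iUnion₂.1 hy
    exact ((convex_segment _ _).segment_subset (left_mem_segment ℝ _ _) hyw).trans
      ((subset_biUnion_of_mem (u := fun w => segment ℝ (P.center v) (P.center w)) hw).trans
        (subset_insert _ _))

variable (P) in
theorem isClosed_drawing : IsClosed P.drawing := by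
  rw [drawing_eq_iUnion_star]
  exact ((P.locallyFinite_closedBall 1).subset fun _ => star_subset_closedBall).isClosed_iUnion
    fun _ => isClosed_star

theorem isConnected_drawing (hconn : P.graph.Connected) : IsConnected P.drawing := by
  have := hconn.nonempty
  rw [drawing_eq_iUnion_star]
  refine IsConnected.iUnion_of_reflTransGen (fun _ => isConnected_star) fun v w => ?_
  refine Relation.ReflTransGen.mono (fun a b hab => ?_) _ _
    ((SimpleGraph.reachable_iff_reflTransGen v w).1 (hconn.preconnected v w))
  exact ⟨P.center b, mem_insert_of_mem _ (mem_biUnion hab (right_mem_segment ℝ _ _)),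
    mem_insert _ _⟩

theorem mem_line_of_mem_drawing (hvw : P.graph.Adj v w)
    (hx : dist x (midpoint ℝ (P.center v) (P.center w)) < 1 / 4) (hxP : x ∈ P.drawing) :
    x ∈ line[ℝ, P.center v, P.center w] := by
  set m := midpoint ℝ (P.center v) (P.center w) with hm
  have h_far : ∀ u, u ≠ v → u ≠ w → 3 / 4 ≤ dist m (P.center u) ^ 2 := fun u huv huw => by
    rw [hm, dist_comm, dist_midpoint_sq, show dist (P.center v) (P.center w) = 1 from hvw]
    nlinarith [P.one_le_dist_center huv, P.one_le_dist_center huw]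
  have h_near : ∀ u, 1 / 4 ≤ dist m (P.center u) ^ 2 := fun u => by
    by_cases huv : u = v
    · rw [hm, huv, dist_midpoint_left, show dist (P.center v) (P.center w) = 1 from hvw]
      norm_num
    by_cases huw : u = w
    · rw [hm, huw, dist_midpoint_right, show dist (P.center v) (P.center w) = 1 from hvw]
      norm_num
    linarith [h_far u huv huw]
  have h_other : ∀ u u', P.graph.Adj u u' → x ∈ segment ℝ (P.center u) (P.center u') →
      u = v ∨ u = w := fun u u' huu' hxu => by
    by_contra! h
    exact absurd (one_fourth_lt_dist_of_mem_segment huu' (h_far u h.1 h.2) (h_near u') hxu)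
      (not_lt.2 (dist_comm m x ▸ hx.le))
  rcases hxP with ⟨u, rfl⟩ | hxP
  · rw [dist_comm] at hx
    nlinarith [h_near u, dist_nonneg (x := m) (y := P.center u)]
  · simp only [mem_iUnion] at hxP
    obtain ⟨u, u', huu', hxu⟩ := hxP
    rcases h_other u u' huu' hxu, h_other u' u huu'.symm (by rwa [segment_symm]) with
      ⟨rfl | rfl, rfl | rfl⟩
    · exact absurd huu' (P.graph.loopless.irrefl _)
    · exact (mem_segment_iff_wbtw.1 hxu).mem_affineSpan
    · exact (mem_segment_iff_wbtw.1 hxu).symm.mem_affineSpan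
    · exact absurd huu' (P.graph.loopless.irrefl _)

end Drawing

section Faces

variable {P} {σ K : Set (EuclideanSpace ℝ (Fin 2))}

theorem isOpen_face (hσ : σ ∈ P.faces) : IsOpen σ := by
  obtain ⟨x, -, rfl⟩ := hσ
  exact P.isClosed_drawing.isOpen_compl.connectedComponentIn

theorem isPreconnected_face (hσ : σ ∈ P.faces) : IsPreconnected σ := by
  obtain ⟨x, -, rfl⟩ := hσ
  exact isPreconnected_connectedComponentIn

theorem notMem_drawing_of_mem_face (hσ : σ ∈ P.faces) (hx : x ∈ σ) : x ∉ P.drawing := by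
  obtain ⟨y, -, rfl⟩ := hσ
  exact connectedComponentIn_subset _ _ hx

theorem subset_face_of_isPreconnected (hσ : σ ∈ P.faces) (hK : IsPreconnected K)
    (hKP : K ⊆ P.drawingᶜ) (hKσ : (K ∩ σ).Nonempty) : K ⊆ σ := by
  obtain ⟨x, -, rfl⟩ := hσ
  obtain ⟨y, hyK, hyσ⟩ := hKσ
  rw [connectedComponentIn_eq hyσ]
  exact hK.subset_connectedComponentIn hyK hKP

theorem exists_mem_face (hx : x ∉ P.drawing) : ∃ σ ∈ P.faces, x ∈ σ :=
  ⟨_, ⟨x, hx, rfl⟩, mem_connectedComponentIn hx⟩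

theorem frontier_face_subset_drawing (hσ : σ ∈ P.faces) : frontier σ ⊆ P.drawing := by
  obtain ⟨x, -, rfl⟩ := hσ
  simpa using frontier_connectedComponentIn_subset_compl P.isClosed_drawing.isOpen_compl x

theorem frontier_face_nonempty [Nonempty V] (hσ : σ ∈ P.faces) : (frontier σ).Nonempty := by
  refine nonempty_frontier_iff.2 ⟨?_, ?_⟩
  · obtain ⟨x, hx, rfl⟩ := hσ
    exact ⟨x, mem_connectedComponentIn hx⟩
  · rintro rfl
    exact notMem_drawing_of_mem_face hσ (mem_univ (P.center (Classical.arbitrary V)))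
      center_mem_drawing

theorem isPreconnected_frontier_face (hconn : P.graph.Connected) (hσ : σ ∈ P.faces) :
    IsPreconnected (frontier σ) := by
  obtain ⟨x, -, rfl⟩ := hσ
  exact isPreconnected_frontier_connectedComponentIn_compl (isConnected_drawing hconn)
    P.isClosed_drawing x

end Faces

section Corners

variable {σ : Set (EuclideanSpace ℝ (Fin 2))}

/-- The vertices at which the face `σ` has a corner. -/
def cornerVertices (σ : Set (EuclideanSpace ℝ (Fin 2))) : Set V :=
  {v | (σ ∩ P.penny v).Nonempty}

theorem encard_cornerVertices_le_facialDegree (σ : Set (EuclideanSpace ℝ (Fin 2))) :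
    (P.cornerVertices σ).encard ≤ P.facialDegree σ := by
  refine le_trans (encard_le_encard ?_) (encard_image_le Prod.fst (P.corners σ))
  rintro v ⟨x, hx⟩
  exact ⟨(v, connectedComponentIn (σ ∩ P.penny v) x), ⟨x, hx, rfl⟩, rfl⟩

/-- The vertex `v` is an anchor of the point `x` of the plane if every face close to `x` has a
corner at `v` and, in case `x` lies on the drawing, `x` lies on the closed penny of `v`. This is the
choice of a vertex near `x` that is stable under small displacements of `x`. -/
def IsAnchor (x : EuclideanSpace ℝ (Fin 2)) (v : V) : Prop :=
  (x ∈ P.drawing → x ∈ closedBall (P.center v) (1 / 2)) ∧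
    ∀ᶠ y in 𝓝 x, ∀ σ ∈ P.faces, y ∈ σ → v ∈ P.cornerVertices σ

variable {P}

theorem IsAnchor.mem_cornerVertices (h : P.IsAnchor x v) (hσ : σ ∈ P.faces) (hx : x ∈ closure σ) :
    v ∈ P.cornerVertices σ := by
  obtain ⟨y, hyσ, hy⟩ := ((mem_closure_iff_frequently.1 hx).and_eventually h.2).exists
  exact hy σ hσ hyσ

theorem isAnchor_of_mem_penny (hx : x ∈ P.penny v) : P.IsAnchor x v :=
  ⟨fun _ => ball_subset_closedBall hx, (isOpen_ball.eventually_mem hx).mono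
    fun y hy _ _ hyσ => ⟨y, hyσ, hy⟩⟩

theorem isAnchor_center (v : V) : P.IsAnchor (P.center v) v :=
  isAnchor_of_mem_penny (mem_ball_self (by norm_num))

theorem isAnchor_of_mem_cornerVertices (hσ : σ ∈ P.faces) (hx : x ∈ σ)
    (hv : v ∈ P.cornerVertices σ) : P.IsAnchor x v := by
  refine ⟨fun h => absurd h (notMem_drawing_of_mem_face hσ hx), ?_⟩
  filter_upwards [(isOpen_face hσ).mem_nhds hx] with y hy τ hτ hyτ
  have hστ : σ ⊆ τ := subset_face_of_isPreconnected hτ (isPreconnected_face hσ)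
    (fun _ => notMem_drawing_of_mem_face hσ) ⟨y, hy, hyτ⟩
  exact hv.mono (inter_subset_inter_left _ hστ)

/-- Near the midpoint of an edge the drawing lies on the line through the edge, so a displacement
parallel to the edge does not cross the drawing. -/
theorem smul_add_mem_face (hvw : P.graph.Adj v w) (hσ : σ ∈ P.faces) (hyσ : y ∈ σ)
    (hy : dist y (midpoint ℝ (P.center v) (P.center w)) < 1 / 8) {s : ℝ} (hs : |s| ≤ 1 / 8) :
    s • (P.center v - P.center w) + y ∈ σ := by
  set m := midpoint ℝ (P.center v) (P.center w)
  set d := P.center v - P.center w with hd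
  have hvw' : dist (P.center v) (P.center w) = 1 := hvw
  have hd_norm : ‖d‖ = 1 := by rw [hd, ← dist_eq_norm, hvw']
  have hy_line : y ∉ line[ℝ, P.center v, P.center w] := fun h =>
    notMem_drawing_of_mem_face hσ hyσ (segment_subset_drawing hvw
      (mem_segment_of_mem_line h (by rw [hvw']; linarith)))
  suffices h_slide : (fun s : ℝ => s • d + y) '' Icc (-(1 / 8)) (1 / 8) ⊆ σ from
    h_slide ⟨s, abs_le.1 hs, rfl⟩
  refine subset_face_of_isPreconnected hσ (isPreconnected_Icc.image _ (by fun_prop)) ?_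
    ⟨y, ⟨0, by norm_num, by simp⟩, hyσ⟩
  rintro _ ⟨t, ht, rfl⟩ h_mem
  have h_dist : dist (t • d + y) m < 1 / 4 := by
    have h_triangle := dist_triangle (t • d + y) y m
    rw [dist_eq_norm (t • d + y) y, add_sub_cancel_right, norm_smul, hd_norm,
      Real.norm_eq_abs] at h_triangle
    linarith [abs_le.2 ht]
  have h_dir : t • d ∈ (line[ℝ, P.center v, P.center w]).direction :=
    Submodule.smul_mem _ t (AffineSubspace.vsub_mem_direction (left_mem_affineSpan_pair _ _ _)
      (right_mem_affineSpan_pair _ _ _))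
  exact hy_line ((AffineSubspace.vadd_mem_iff_mem_of_mem_direction h_dir).1
    (mem_line_of_mem_drawing hvw h_dist h_mem))

theorem isAnchor_midpoint (hvw : P.graph.Adj v w) :
    P.IsAnchor (midpoint ℝ (P.center v) (P.center w)) v := by
  set m := midpoint ℝ (P.center v) (P.center w) with hm
  set d := P.center v - P.center w with hd
  have hvw' : dist (P.center v) (P.center w) = 1 := hvw
  have hd_norm : ‖d‖ = 1 := by rw [hd, ← dist_eq_norm, hvw']
  refine ⟨fun _ => by rw [mem_closedBall, hm, dist_midpoint_left, hvw']; norm_num, ?_⟩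
  filter_upwards [ball_mem_nhds m (by norm_num : (0 : ℝ) < 1 / 8)] with y hy σ hσ hyσ
  refine ⟨(1 / 8 : ℝ) • d + y,
    smul_add_mem_face hvw hσ hyσ hy (abs_of_pos (by norm_num)).le, ?_⟩
  have h_end : (1 / 8 : ℝ) • d + y - P.center v = (y - m) + -((3 / 8 : ℝ) • d) := by
    rw [hm, midpoint_eq_smul_add, invOf_eq_inv, hd]
    module
  rw [mem_ball, dist_eq_norm] at hy
  rw [penny, mem_ball, dist_eq_norm, h_end]
  calc ‖(y - m) + -((3 / 8 : ℝ) • d)‖ ≤ ‖y - m‖ + 3 / 8 * ‖d‖ := by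
        refine (norm_add_le _ _).trans_eq ?_
        rw [norm_neg, norm_smul, Real.norm_of_nonneg (by norm_num)]
    _ < 1 / 2 := by linarith

theorem exists_isAnchor_of_mem_drawing (hx : x ∈ P.drawing) : ∃ v, P.IsAnchor x v := by
  rcases hx with ⟨v, rfl⟩ | hx
  · exact ⟨v, isAnchor_center v⟩
  simp only [mem_iUnion] at hx
  obtain ⟨v, w, hvw, hx⟩ := hx
  have hvw' : dist (P.center v) (P.center w) = 1 := hvw
  have h_add := dist_add_dist_of_mem_segment hx
  rcases lt_trichotomy (dist (P.center v) x) (1 / 2) with h | h | h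
  · exact ⟨v, isAnchor_of_mem_penny (mem_ball'.2 h)⟩
  · have hx_mid : x = midpoint ℝ (P.center v) (P.center w) :=
      eq_midpoint_of_dist_eq_half (by linarith) (by linarith)
    exact ⟨v, hx_mid ▸ isAnchor_midpoint hvw⟩
  · exact ⟨w, isAnchor_of_mem_penny (mem_ball.2 (by linarith))⟩

theorem exists_isAnchor [Nonempty V] (x : EuclideanSpace ℝ (Fin 2)) : ∃ v, P.IsAnchor x v := by
  by_cases hx : x ∈ P.drawing
  · exact exists_isAnchor_of_mem_drawing hx
  obtain ⟨σ, hσ, hxσ⟩ := exists_mem_face hx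
  obtain ⟨y, hy⟩ := frontier_face_nonempty hσ
  obtain ⟨v, hv⟩ := exists_isAnchor_of_mem_drawing (frontier_face_subset_drawing hσ hy)
  exact ⟨v, isAnchor_of_mem_cornerVertices hσ hxσ
    (hv.mem_cornerVertices hσ (frontier_subset_closure hy))⟩

end Corners

section QuasiIsometry

variable {P} {σ : Set (EuclideanSpace ℝ (Fin 2))} {D : ℕ}

variable (P) in
theorem eventually_mem_closedBall_of_mem (x : EuclideanSpace ℝ (Fin 2)) :
    ∀ᶠ y in 𝓝 x, ∀ v, y ∈ closedBall (P.center v) (1 / 2) → x ∈ closedBall (P.center v) (1 / 2) :=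
  (P.locallyFinite_closedBall (1 / 2)).eventually_subset (fun _ => isClosed_closedBall) x

theorem exists_mem_cornerVertices_of_mem_frontier (hσ : σ ∈ P.faces) (hx : x ∈ frontier σ) :
    ∃ v ∈ P.cornerVertices σ, x ∈ closedBall (P.center v) (1 / 2) := by
  have hxP := frontier_face_subset_drawing hσ hx
  obtain ⟨v, hv⟩ := exists_isAnchor_of_mem_drawing hxP
  exact ⟨v, hv.mem_cornerVertices hσ (frontier_subset_closure hx), hv.1 hxP⟩

theorem exists_mem_frontier_of_mem_cornerVertices (hσ : σ ∈ P.faces)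
    (hv : v ∈ P.cornerVertices σ) : ∃ x ∈ frontier σ, x ∈ closedBall (P.center v) (1 / 2) := by
  have h_meets := inter_frontier_nonempty_of_isPreconnected
    (convex_ball (P.center v) (1 / 2)).isPreconnected (inter_comm σ _ ▸ hv)
    ⟨P.center v, mem_ball_self (by norm_num), fun h =>
      notMem_drawing_of_mem_face hσ h center_mem_drawing⟩
  exact h_meets.imp fun x hx => ⟨hx.2, ball_subset_closedBall hx.1⟩

theorem graphDist_le_of_mem_cornerVertices (hconn : P.graph.Connected) (hσ : σ ∈ P.faces)
    (hD : P.facialDegree σ ≤ D) (hv : v ∈ P.cornerVertices σ) (hw : w ∈ P.cornerVertices σ) :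
    graphDist P.graph v w ≤ D := by
  obtain ⟨x, hx, hxv⟩ := exists_mem_frontier_of_mem_cornerVertices hσ hv
  obtain ⟨y, hy, hyw⟩ := exists_mem_frontier_of_mem_cornerVertices hσ hw
  rw [← one_mul (D : ℝ)]
  refine graphDist_le_of_isPreconnected hconn (isPreconnected_frontier_face hconn hσ)
    (R := fun x v => v ∈ P.cornerVertices σ ∧ x ∈ closedBall (P.center v) (1 / 2))
    (fun x hx => exists_mem_cornerVertices_of_mem_frontier hσ hx) (fun x _ v hv => ?_)
    ((encard_le_encard ?_).trans ((P.encard_cornerVertices_le_facialDegree σ).trans hD))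
    hx hy ⟨hv, hxv⟩ ⟨hw, hyw⟩
  · filter_upwards [nhdsWithin_le_nhds (P.eventually_mem_closedBall_of_mem x)] with y hy w hw
    exact graphDist_le_one_of_eq_or_adj (eq_or_adj_of_mem_closedBall hv.2 (hy w hw.2))
  · exact fun u ⟨_, _, hu⟩ => hu.1

theorem dist_center_le_graphDist (hconn : P.graph.Connected) (v w : V) :
    dist (P.center v) (P.center w) ≤ graphDist P.graph v w := by
  rw [← one_mul (graphDist _ _ _)]
  exact le_mul_graphDist hconn (d := fun v w => dist (P.center v) (P.center w))
    (fun _ => dist_self _) (fun _ _ _ => dist_triangle _ _ _) (fun _ _ h => le_of_eq h) v w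

/-- Otherwise the face would meet the exterior of a disk around the corner that contains its whole
boundary, hence contain that exterior, where infinitely many centers lie. -/
theorem dist_center_le_of_mem_face [Infinite V] (hconn : P.graph.Connected) (hσ : σ ∈ P.faces)
    (hD : P.facialDegree σ ≤ D) (hv : v ∈ P.cornerVertices σ) (hx : x ∈ σ) :
    dist x (P.center v) ≤ D + 1 := by
  by_contra h_far
  have h_rank : 1 < Module.rank ℝ (EuclideanSpace ℝ (Fin 2)) := by
    rw [← Module.finrank_eq_rank, finrank_euclideanSpace_fin]
    norm_num
  obtain ⟨u, hu⟩ := (P.finite_center_mem_closedBall (P.center v) (D + 1)).exists_notMem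
  obtain ⟨z, hz, hzσ⟩ := inter_frontier_nonempty_of_isPreconnected
    (isPreconnected_compl_closedBall h_rank (P.center v) (by positivity)) ⟨x, h_far, hx⟩
    ⟨P.center u, hu, fun h => notMem_drawing_of_mem_face hσ h center_mem_drawing⟩
  obtain ⟨w, hw, hzw⟩ := exists_mem_cornerVertices_of_mem_frontier hσ hzσ
  refine hz ?_
  rw [mem_closedBall] at hzw ⊢
  linarith [dist_triangle z (P.center w) (P.center v), dist_center_le_graphDist hconn w v,
    graphDist_le_of_mem_cornerVertices hconn hσ hD hw hv]

variable (hconn : P.graph.Connected) (hD : ∀ σ ∈ P.faces, P.facialDegree σ ≤ D)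

include hconn hD

theorem IsAnchor.dist_le [Infinite V] (h : P.IsAnchor x v) : dist x (P.center v) ≤ D + 1 := by
  by_cases hx : x ∈ P.drawing
  · have h_penny := mem_closedBall.1 (h.1 hx)
    linarith [D.cast_nonneg (α := ℝ)]
  · obtain ⟨σ, hσ, hxσ⟩ := exists_mem_face hx
    exact dist_center_le_of_mem_face hconn hσ (hD σ hσ)
      (h.mem_cornerVertices hσ (subset_closure hxσ)) hxσ

theorem IsAnchor.eventually_graphDist_le (h : P.IsAnchor x v) :
    ∀ᶠ y in 𝓝 x, ∀ w, P.IsAnchor y w → graphDist P.graph v w ≤ D + 1 := by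
  have h_drawing : ∀ᶠ y in 𝓝 x, y ∈ P.drawing → x ∈ P.drawing := by
    by_cases hx : x ∈ P.drawing
    · exact .of_forall fun _ _ => hx
    · exact (P.isClosed_drawing.isOpen_compl.eventually_mem hx).mono fun _ hy h => absurd h hy
  filter_upwards [h.2, h_drawing, P.eventually_mem_closedBall_of_mem x] with y hy hyx hy_penny w hw
  by_cases hyP : y ∈ P.drawing
  · have h_one := graphDist_le_one_of_eq_or_adj
      (eq_or_adj_of_mem_closedBall (h.1 (hyx hyP)) (hy_penny w (hw.1 hyP)))
    linarith [D.cast_nonneg (α := ℝ)]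
  · obtain ⟨σ, hσ, hyσ⟩ := exists_mem_face hyP
    linarith [graphDist_le_of_mem_cornerVertices hconn hσ (hD σ hσ) (hy σ hσ hyσ)
      (hw.mem_cornerVertices hσ (subset_closure hyσ))]

theorem exists_graphDist_le_of_dist_le_one [Infinite V] : ∃ K : ℝ, ∀ x y v w,
    P.IsAnchor x v → P.IsAnchor y w → dist x y ≤ 1 → graphDist P.graph v w ≤ K := by
  obtain ⟨N, hN⟩ := P.exists_forall_encard_center_le (D + 2)
  refine ⟨(D + 1) * N, fun x y v w hv hw hxy => ?_⟩
  refine graphDist_le_of_isPreconnected hconn (convex_closedBall x 1).isPreconnected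
    (fun z _ => exists_isAnchor z)
    (fun z _ u hu => nhdsWithin_le_nhds (hu.eventually_graphDist_le hconn hD))
    ((encard_le_encard ?_).trans (hN x)) (mem_closedBall_self zero_le_one) (mem_closedBall'.2 hxy)
    hv hw
  rintro u ⟨z, hzx, hzu⟩
  rw [mem_closedBall] at hzx
  rw [mem_ofPred_eq, mem_closedBall]
  linarith [dist_triangle_left (P.center u) x z, hzu.dist_le hconn hD]

theorem quasiIsometric_center [Infinite V] :
    QuasiIsometric (graphDist P.graph) (dist (α := EuclideanSpace ℝ (Fin 2))) := by
  obtain ⟨K, hK⟩ := exists_graphDist_le_of_dist_le_one hconn hD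
  refine ⟨P.center, max K 1, D + 2, le_max_right _ _, by positivity, fun v w => ⟨?_, ?_⟩,
    fun x => ?_⟩
  · have h_lower : graphDist P.graph v w ≤ max K 1 * (dist (P.center v) (P.center w) + 1) :=
      (graphDist_le_mul_dist_add_one hconn exists_isAnchor hK (isAnchor_center v)
        (isAnchor_center w)).trans (by gcongr; exact le_max_left _ _)
    rw [← inv_mul_le_iff₀ (by positivity)] at h_lower
    linarith [D.cast_nonneg (α := ℝ)]
  · calc dist (P.center v) (P.center w) ≤ 1 * graphDist P.graph v w := by
          rw [one_mul]; exact dist_center_le_graphDist hconn v w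
      _ ≤ max K 1 * graphDist P.graph v w := by
          gcongr
          exacts [Nat.cast_nonneg _, le_max_right _ _]
      _ ≤ _ := le_add_of_nonneg_right (by positivity)
  · obtain ⟨v, hv⟩ := exists_isAnchor (P := P) x
    exact ⟨v, (hv.dist_le hconn hD).trans_lt (by linarith)⟩

end QuasiIsometry

end PennyConfiguration

theorem QuasiIsometric.trans {X Y Z : Type*} {dX : X → X → ℝ} {dY : Y → Y → ℝ} {dZ : Z → Z → ℝ}
    (h₁ : QuasiIsometric dX dY) (h₂ : QuasiIsometric dY dZ)
    (h_triangle : ∀ x y z, dZ x z ≤ dZ x y + dZ y z) : QuasiIsometric dX dZ := by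
  obtain ⟨φ, a, C, ha, hC, hφ, hφ_dense⟩ := h₁
  obtain ⟨ψ, b, D, hb, hD, hψ, hψ_dense⟩ := h₂
  have : 0 < a := one_pos.trans_le ha
  have : 0 < b := one_pos.trans_le hb
  refine ⟨ψ ∘ φ, b * a, b * C + 2 * D, one_le_mul_of_one_le_of_one_le hb ha, by positivity,
    fun x₁ x₂ => ⟨?_, ?_⟩, fun z => ?_⟩
  · have h_inv : b⁻¹ * C ≤ b * C := by
      gcongr
      exact (inv_le_one_of_one_le₀ hb).trans hb
    calc (b * a)⁻¹ * dX x₁ x₂ - (b * C + 2 * D)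
      _ ≤ b⁻¹ * (a⁻¹ * dX x₁ x₂ - C) - D := by rw [mul_inv, mul_sub, mul_assoc]; linarith
      _ ≤ b⁻¹ * dY (φ x₁) (φ x₂) - D := by gcongr; exact (hφ x₁ x₂).1
      _ ≤ dZ (ψ (φ x₁)) (ψ (φ x₂)) := (hψ _ _).1
  · calc dZ (ψ (φ x₁)) (ψ (φ x₂)) ≤ b * dY (φ x₁) (φ x₂) + D := (hψ _ _).2
      _ ≤ b * (a * dX x₁ x₂ + C) + D := by gcongr; exact (hφ x₁ x₂).2
      _ ≤ b * a * dX x₁ x₂ + (b * C + 2 * D) := by linarith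
  · obtain ⟨y, hy⟩ := hψ_dense z
    obtain ⟨x, hx⟩ := hφ_dense y
    refine ⟨x, ?_⟩
    calc dZ z (ψ (φ x)) ≤ dZ z (ψ y) + dZ (ψ y) (ψ (φ x)) := h_triangle _ _ _
      _ ≤ dZ z (ψ y) + (b * dY y (φ x) + D) := by gcongr; exact (hψ _ _).2
      _ < D + (b * C + D) := by gcongr
      _ = b * C + 2 * D := by ring

section Lattice

theorem exists_walk_length_eq_natAbs_sub {V : Type*} {G : SimpleGraph V} {f : ℤ → V}
    (hf : ∀ i, G.Adj (f i) (f (i + 1))) (i j : ℤ) :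
    ∃ p : G.Walk (f i) (f j), p.length = (i - j).natAbs := by
  have h_up : ∀ (n : ℕ) (i : ℤ), ∃ p : G.Walk (f i) (f (i + n)), p.length = n := fun n => by
    induction n with
    | zero => exact fun i => ⟨SimpleGraph.Walk.nil.copy rfl (by simp), by simp⟩
    | succ n ih =>
      intro i
      obtain ⟨p, hp⟩ := ih i
      exact ⟨(p.concat (hf _)).copy rfl (by push_cast; rw [add_assoc]), by simp [hp]⟩
  rcases le_total i j with hij | hji
  · obtain ⟨p, hp⟩ := h_up (i - j).natAbs i
    exact ⟨p.copy rfl (by congr 1; omega), by simpa using hp⟩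
  · obtain ⟨p, hp⟩ := h_up (i - j).natAbs j
    exact ⟨(p.copy rfl (by congr 1; omega)).reverse, by simpa using hp⟩

theorem exists_latticeGraph_walk (w z : ℤ × ℤ) :
    ∃ p : latticeGraph.Walk w z, p.length = (w.1 - z.1).natAbs + (w.2 - z.2).natAbs := by
  obtain ⟨p, hp⟩ := exists_walk_length_eq_natAbs_sub (G := latticeGraph) (f := fun i => (i, w.2))
    (fun i => by simp [latticeGraph]) w.1 z.1
  obtain ⟨q, hq⟩ := exists_walk_length_eq_natAbs_sub (G := latticeGraph) (f := fun j => (z.1, j))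
    (fun j => by simp [latticeGraph]) w.2 z.2
  exact ⟨p.append q, by rw [SimpleGraph.Walk.length_append, hp, hq]⟩

theorem latticeGraph_connected : latticeGraph.Connected where
  preconnected w z := (exists_latticeGraph_walk w z).elim fun p _ => ⟨p⟩
  nonempty := ⟨0⟩

theorem graphDist_latticeGraph (w z : ℤ × ℤ) :
    graphDist latticeGraph w z = |(w.1 : ℝ) - z.1| + |(w.2 : ℝ) - z.2| := by
  refine le_antisymm ?_ ?_
  · obtain ⟨p, hp⟩ := exists_latticeGraph_walk w z
    calc graphDist latticeGraph w z ≤ p.length := Nat.cast_le.2 (SimpleGraph.dist_le p)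
      _ = |(w.1 : ℝ) - z.1| + |(w.2 : ℝ) - z.2| := by
        rw [hp]
        push_cast [Nat.cast_natAbs]
        rfl
  · rw [← one_mul (graphDist _ _ _)]
    refine le_mul_graphDist latticeGraph_connected
      (d := fun w z : ℤ × ℤ => |(w.1 : ℝ) - z.1| + |(w.2 : ℝ) - z.2|) (fun _ => by simp)
      (fun u v w => ?_) (fun w z hwz => ?_) w z
    · linarith [abs_sub_le (u.1 : ℝ) v.1 w.1, abs_sub_le (u.2 : ℝ) v.2 w.2]
    · have h_abs_le_sq : ∀ n : ℤ, |n| ≤ n ^ 2 := fun n => sq_abs n ▸ Int.le_self_sq |n|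
      have h_sq : (w.1 - z.1) ^ 2 + (w.2 - z.2) ^ 2 = 1 := hwz
      exact_mod_cast (add_le_add (h_abs_le_sq _) (h_abs_le_sq _)).trans_eq h_sq

theorem abs_abs_floor_sub_floor_sub_abs_sub_le (s t : ℝ) :
    |(|(⌊s⌋ : ℝ) - ⌊t⌋| - |s - t|)| ≤ 1 := by
  refine (abs_abs_sub_abs_le _ _).trans (abs_le.2 ⟨?_, ?_⟩) <;>
  linarith [Int.floor_le s, Int.lt_floor_add_one s, Int.floor_le t, Int.lt_floor_add_one t]

theorem dist_le_abs_sub_add_abs_sub (x y : EuclideanSpace ℝ (Fin 2)) :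
    dist x y ≤ |x 0 - y 0| + |x 1 - y 1| := by
  rw [EuclideanSpace.dist_eq, Fin.sum_univ_two, Real.dist_eq, Real.dist_eq]
  refine Real.sqrt_le_iff.2 ⟨by positivity, ?_⟩
  linarith [mul_nonneg (abs_nonneg (x 0 - y 0)) (abs_nonneg (x 1 - y 1)),
    add_sq |x 0 - y 0| |x 1 - y 1|]

theorem quasiIsometric_floor :
    QuasiIsometric (dist (α := EuclideanSpace ℝ (Fin 2))) (graphDist latticeGraph) := by
  let ψ : EuclideanSpace ℝ (Fin 2) → ℤ × ℤ := fun x => (⌊x 0⌋, ⌊x 1⌋)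
  refine ⟨ψ, 2, 3, by norm_num, by norm_num, fun x y => ?_, fun z => ?_⟩
  · have h_coord : ∀ i, |x i - y i| ≤ dist x y := fun i => by
      rw [dist_eq_norm]
      exact PiLp.norm_apply_le (x - y) i
    have h_floor := fun i => abs_le.1 (abs_abs_floor_sub_floor_sub_abs_sub_le (x i) (y i))
    rw [graphDist_latticeGraph]
    constructor <;>
    linarith [h_coord 0, h_coord 1, h_floor 0, h_floor 1, dist_le_abs_sub_add_abs_sub x y]
  · exact ⟨!₂[(z.1 : ℝ), z.2], by simp [ψ, graphDist_self]⟩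

end Lattice

theorem theorem1p1 {V : Type*} [Infinite V] (P : PennyConfiguration V)
    (hconn : P.graph.Connected)
    (hdeg : (⨆ σ ∈ P.faces, P.facialDegree σ) < ⊤) :
    QuasiIsometric (graphDist P.graph) (graphDist latticeGraph) := by
  obtain ⟨D, hD⟩ := ENat.ne_top_iff_exists.1 hdeg.ne
  have h_facialDegree : ∀ σ ∈ P.faces, P.facialDegree σ ≤ D := fun σ hσ =>
    hD ▸ le_iSup₂ (f := fun σ (_ : σ ∈ P.faces) => P.facialDegree σ) σ hσ
  exact (PennyConfiguration.quasiIsometric_center hconn h_facialDegree).trans quasiIsometric_floor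
    (graphDist_triangle latticeGraph_connected)
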